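/- All groups are finite and all representations and characters are complex. For a finite group $G$ let $\mathrm{Irr}(G)$ be its set of irreducible characters, with $\langle\varphi,\psi\rangle=\frac1{|G|}\sum_{g\in G}\varphi(g)\overline{\psi(g)}$; a character $\chi$ is multiplicity free if $\langle\chi,\mu\rangle\le 1$ for every $\mu\in\mathrm{Irr}(G)$. For a normal subgroup $N$ of $G$ and $\mu\in\mathrm{Irr}(N)$ let $I_G(\mu)=\{g\in G\mid \mu(g^{-1}ng)=\mu(n)\text{ for all }n\in N\}$. The group $G$ is unramified over a nontrivial abelian normal subgroup $N$ if for every irreducible representation $\rho$ of $G$ the restriction $\rho|_N$ is multiplicity free (its character is) or trivial ($N$ acts by the identity). The group $G$ is totally unramified if it is abelian or there is a nontrivial abelian normal subgroup $N$ such that $G$ is unramified over $N$ and $G/N$ is totally unramified (recursively). (1) Let $N$ be a nontrivial abelian normal subgroup of a finite group $G$. If $I_G(\mu)/N$ is cyclic for every $\mu\in\mathrm{Irr}(N)$, then $G$ is unramified over $N$. In particular, if $G/N$ is cyclic, then $G$ is unramified over $N$. (2) Every finite metacyclic group (a group with a cyclic normal subgroup whose quotient is cyclic) is totally unramified. -/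

import Mathlib

universe u

/-- The set `Irr(G)` of complex irreducible characters of a finite group `G`, as functions `G → ℂ`.
(Irreducible representations of a finite group are finite dimensional, so those on a complex
vector space in `Type` already give all the characters.) -/
def Irr (G : Type u) [Group G] : Set (G → ℂ) :=
  {χ | ∃ (V : Type) (_ : AddCommGroup V) (_ : Module ℂ V) (_ : FiniteDimensional ℂ V)
    (ρ : Representation ℂ G V), ρ.IsIrreducible ∧ ρ.character = χ}

/-- The scalar product `⟨φ, ψ⟩ = |G|⁻¹ ∑_g φ(g) conj(ψ(g))` of complex functions on a finite group. -/
noncomputable def charInner {G : Type u} [Group G] [Finite G] (φ ψ : G → ℂ) : ℂ :=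
  (Nat.card G : ℂ)⁻¹ * ∑ᶠ g : G, φ g * (starRingEnd ℂ) (ψ g)

open scoped ComplexOrder in
/-- A character `χ` is multiplicity free if `⟨χ, μ⟩ ≤ 1` for every irreducible character `μ`.
For characters `⟨χ, μ⟩` is a natural number; `≤` is the usual partial order on `ℂ`
(comparable real parts and equal imaginary parts). -/
def IsMultiplicityFree {G : Type u} [Group G] [Finite G] (χ : G → ℂ) : Prop :=
  ∀ μ ∈ Irr G, charInner χ μ ≤ 1

/-- The inertia subgroup `I_G(μ) = {g ∈ G | μ(g⁻¹ n g) = μ(n) for all n ∈ N}` of a function `μ`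
on a normal subgroup `N`. -/
def inertia {G : Type u} [Group G] (N : Subgroup G) [hN : N.Normal] (μ : N → ℂ) : Subgroup G where
  carrier := {g | ∀ n : N, μ ⟨g⁻¹ * n * g, by simpa using hN.conj_mem n n.2 g⁻¹⟩ = μ n}
  one_mem' := by intro n; simp
  mul_mem' := by
    intro a b ha hb n
    have h1 := hb ⟨a⁻¹ * n * a, by simpa using hN.conj_mem n n.2 a⁻¹⟩
    rw [ha n] at h1
    rw [← h1]
    congr 2
    group
  inv_mem' := by
    intro a ha n
    have h1 := ha ⟨a * n * a⁻¹, hN.conj_mem n n.2 a⟩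
    have h2 : (⟨a⁻¹ * (a * n * a⁻¹) * a, by
        simpa using hN.conj_mem _ (hN.conj_mem n n.2 a) a⁻¹⟩ : N) = n := by
      ext; simp; group
    rw [h2] at h1
    rw [h1]
    congr 2
    simp

/-- `N ≤ I_G(μ)` for abelian `N`, so that `N.subgroupOf (inertia N μ)` is `N` as a subgroup
of `I_G(μ)`. -/
theorem le_inertia {G : Type u} [Group G] (N : Subgroup G) [N.Normal] [IsMulCommutative N]
    (μ : N → ℂ) : N ≤ inertia N μ := by
  intro g hg n
  have h : (n : G) * g = g * n := congrArg Subtype.val (mul_comm' n (⟨g, hg⟩ : N))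
  congr 1
  ext
  simp [mul_assoc, h]

/-- `G` is unramified over `N`: the subgroup `N` is normal, abelian and nontrivial, and for every
complex irreducible representation `ρ` of `G` the restriction `ρ|_N` is multiplicity free (that is,
its character is) or trivial (`N` acts by the identity). -/
structure IsUnramifiedOver {G : Type u} [Group G] [Finite G] (N : Subgroup G) : Prop where
  normal : N.Normal
  abelian : IsMulCommutative N
  nontrivial : N ≠ ⊥
  restrict : ∀ (V : Type) [AddCommGroup V] [Module ℂ V] [FiniteDimensional ℂ V]
    (ρ : Representation ℂ G V), ρ.IsIrreducible →
      IsMultiplicityFree (fun n : N => ρ.character (n : G)) ∨ ∀ n ∈ N, ρ n = LinearMap.id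

/-- A finite group is totally unramified if it is abelian, or it is unramified over some
nontrivial abelian normal subgroup `N` such that `G ⧸ N` is totally unramified. -/
inductive IsTotallyUnramified : ∀ (G : Type u) [Group G] [Finite G], Prop where
  | of_abelian (G : Type u) [Group G] [Finite G] (h : IsMulCommutative G) :
      IsTotallyUnramified G
  | of_quotient (G : Type u) [Group G] [Finite G] (N : Subgroup G) [N.Normal]
      (h : IsUnramifiedOver N) (hq : IsTotallyUnramified (G ⧸ N)) : IsTotallyUnramified G

/-- A group is metacyclic if it has a cyclic normal subgroup with cyclic quotient. -/
def IsMetacyclic (G : Type u) [Group G] : Prop :=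
  ∃ (N : Subgroup G) (_ : N.Normal), IsCyclic N ∧ IsCyclic (G ⧸ N)

/-! As `N` is abelian, each irreducible character of `N` is a homomorphism `c`, and its multiplicity
in `ρ|_N` is the trace of the projection onto the `c`-weight space `W`. The inertia group preserves
`W` and `N` acts there by scalars, so when the inertia quotient is cyclic, an eigenvector `v ∈ W` of
a lift of a generator spans a line stable under the whole inertia group
(`exists_inertia_eigenvector`). By irreducibility the orbit of `v` spans `V`, and the projection
sends it into `ℂv` (`trace_weightProj_le_one`). Hence `W` is zero or a line. A metacyclic group then
needs at most one quotient step. -/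

section WeightProjection

variable {G : Type u} [Group G] {V : Type*} [AddCommGroup V] [Module ℂ V]

/-- The projection `|N|⁻¹ ∑_n c(n⁻¹) ρ(n)` onto the weight space of a linear character `c` of a
finite subgroup `N`. -/
noncomputable def weightProj (ρ : Representation ℂ G V) (N : Subgroup G) [Fintype N]
    (c : N →* ℂ) : V →ₗ[ℂ] V :=
  (Nat.card N : ℂ)⁻¹ • ∑ n : N, c n⁻¹ • ρ n

/-- The weight space of a linear character `c` of the subgroup `N`. -/
def weightSpace (ρ : Representation ℂ G V) (N : Subgroup G) (c : N →* ℂ) : Submodule ℂ V where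
  carrier := {v | ∀ n : N, ρ n v = c n • v}
  add_mem' := by
    intro a b ha hb n
    rw [map_add, ha n, hb n, smul_add]
  zero_mem' := by simp
  smul_mem' := by
    intro a v hv n
    rw [map_smul, hv n, smul_comm]

variable (ρ : Representation ℂ G V) (N : Subgroup G)

theorem map_mul_map_inv (c : N →* ℂ) (n : N) : c n * c n⁻¹ = 1 := by
  rw [← map_mul, mul_inv_cancel, map_one]

theorem weightProj_apply [Fintype N] (c : N →* ℂ) (v : V) :
    weightProj ρ N c v = (Nat.card N : ℂ)⁻¹ • ∑ n : N, c n⁻¹ • ρ n v := by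
  simp [weightProj]

theorem weightProj_mem [Fintype N] (c : N →* ℂ) (v : V) :
    weightProj ρ N c v ∈ weightSpace ρ N c := by
  intro m
  rw [weightProj_apply, map_smul, map_sum, smul_comm (c m), Finset.smul_sum (r := c m)]
  congr 1
  refine Fintype.sum_equiv (Equiv.mulLeft m) _ (fun n : N => c m • c n⁻¹ • ρ n v) fun n => ?_
  simp only [Equiv.coe_mulLeft, map_smul, smul_smul, mul_inv_rev, map_mul, Subgroup.coe_mul,
    Module.End.mul_apply]
  rw [mul_left_comm, map_mul_map_inv, mul_one]

theorem weightProj_apply_rho [Fintype N] (c : N →* ℂ) (m : N) (v : V) :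
    weightProj ρ N c (ρ m v) = c m • weightProj ρ N c v := by
  rw [weightProj_apply, weightProj_apply, smul_comm (c m), Finset.smul_sum (r := c m)]
  congr 1
  refine Fintype.sum_equiv (Equiv.mulRight m) _ (fun n : N => c m • c n⁻¹ • ρ n v) fun n => ?_
  simp only [Equiv.coe_mulRight, smul_smul, mul_inv_rev, map_mul, Subgroup.coe_mul,
    Module.End.mul_apply]
  rw [← mul_assoc, map_mul_map_inv, one_mul]

theorem weightProj_eq_self [Fintype N] {c : N →* ℂ} {v : V} (hv : v ∈ weightSpace ρ N c) :
    weightProj ρ N c v = v := by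
  rw [weightProj_apply]
  have h : ∀ n : N, c n⁻¹ • ρ n v = v := fun n => by
    rw [hv n, smul_smul, mul_comm, map_mul_map_inv, one_smul]
  simp only [h, Finset.sum_const, Finset.card_univ, Nat.card_eq_fintype_card]
  rw [← Nat.cast_smul_eq_nsmul ℂ, smul_smul, inv_mul_cancel₀, one_smul]
  exact_mod_cast Fintype.card_ne_zero

theorem weightProj_eq_zero [Fintype N] {c : N →* ℂ} {v : V} {a : ℂ} {m : N} (ha : a ≠ c m)
    (hv : ρ m v = a • v) : weightProj ρ N c v = 0 := by
  have h := weightProj_apply_rho ρ N c m v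
  rw [hv, map_smul, ← sub_eq_zero, ← sub_smul] at h
  exact (smul_eq_zero.mp h).resolve_left (sub_ne_zero.mpr ha)

theorem rho_apply_rho_of_mem_weightSpace [hN : N.Normal] {c : N →* ℂ} {v : V}
    (hv : v ∈ weightSpace ρ N c) (g : G) (n : N) :
    ρ n (ρ g v) =
      c ⟨g⁻¹ * n * g, by simpa using hN.conj_mem n n.2 g⁻¹⟩ • ρ g v := by
  rw [← map_smul, ← hv, ← Module.End.mul_apply, ← Module.End.mul_apply, ← map_mul, ← map_mul]
  congr 2
  simp [mul_assoc]

theorem rho_mem_weightSpace [N.Normal] {c : N →* ℂ} {g : G} (hg : g ∈ inertia N c) {v : V}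
    (hv : v ∈ weightSpace ρ N c) : ρ g v ∈ weightSpace ρ N c := by
  intro n
  rw [rho_apply_rho_of_mem_weightSpace ρ N hv, hg n]

/-- Outside the inertia group, `g` carries the weight `c` to a different conjugate weight, which the
projection kills. -/
theorem weightProj_rho_eq_zero [N.Normal] [Fintype N] {c : N →* ℂ} {g : G}
    (hg : g ∉ inertia N c) {v : V} (hv : v ∈ weightSpace ρ N c) :
    weightProj ρ N c (ρ g v) = 0 := by
  obtain ⟨n, hn⟩ := not_forall.mp hg
  exact weightProj_eq_zero ρ N hn (rho_apply_rho_of_mem_weightSpace ρ N hv g n)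

/-- The orbit of a nonzero vector spans an irreducible representation. -/
theorem span_range_orbit_eq_top (hρ : ρ.IsIrreducible) {v : V} (hv : v ≠ 0) :
    Submodule.span ℂ (Set.range fun g => ρ g v) = ⊤ := by
  let σ : Subrepresentation ρ :=
    { toSubmodule := Submodule.span ℂ (Set.range fun g => ρ g v)
      apply_mem_toSubmodule := by
        intro g w hw
        induction hw using Submodule.span_induction with
        | mem x hx =>
          obtain ⟨h, rfl⟩ := hx
          refine Submodule.subset_span ⟨g * h, ?_⟩
          simp
        | zero => simp
        | add x y _ _ hx hy => rw [map_add]; exact add_mem hx hy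
        | smul a x _ hx => rw [map_smul]; exact Submodule.smul_mem _ a hx }
  rcases hρ.eq_bot_or_eq_top σ with h | h
  · have hmem : v ∈ σ.toSubmodule := Submodule.subset_span ⟨1, by simp⟩
    rw [h] at hmem
    exact absurd ((Submodule.mem_bot ℂ).mp hmem) hv
  · exact congrArg Subrepresentation.toSubmodule h

/-- If the inertia quotient is cyclic, a nonzero weight space contains a common eigenvector of the
inertia group. -/
theorem exists_inertia_eigenvector [Finite G] [FiniteDimensional ℂ V] [N.Normal] {c : N →* ℂ}
    (hcyc : IsCyclic (inertia N c ⧸ N.subgroupOf (inertia N c)))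
    (hne : weightSpace ρ N c ≠ ⊥) :
    ∃ v ∈ weightSpace ρ N c, v ≠ 0 ∧ ∀ g ∈ inertia N c, ρ g v ∈ Submodule.span ℂ {v} := by
  -- By finiteness natural powers of a generator suffice, so `a⁻¹` never occurs.
  obtain ⟨q, hq⟩ := IsCyclic.exists_monoid_generator
    (α := inertia N c ⧸ N.subgroupOf (inertia N c))
  obtain ⟨x, rfl⟩ := QuotientGroup.mk_surjective q
  have : Nontrivial (weightSpace ρ N c) := Submodule.nontrivial_iff_ne_bot.mpr hne
  obtain ⟨a, ha⟩ := Module.End.exists_eigenvalue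
    ((ρ (x : G)).restrict fun v hv => rho_mem_weightSpace ρ N x.2 hv)
  obtain ⟨⟨v, hvW⟩, hv⟩ := ha.exists_hasEigenvector
  have hx : ρ (x : G) v = a • v := congrArg Subtype.val hv.apply_eq_smul
  have hpow : ∀ k : ℕ, ρ ((x : G) ^ k) v = a ^ k • v := by
    intro k
    induction k with
    | zero => simp
    | succ k ih =>
      rw [pow_succ, map_mul, Module.End.mul_apply, hx, map_smul, ih, smul_smul, pow_succ, mul_comm]
  refine ⟨v, hvW, fun h => hv.2 (Subtype.ext h), fun g hg => ?_⟩
  obtain ⟨k, hk⟩ := hq (QuotientGroup.mk ⟨g, hg⟩)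
  have hn : (((x : G) ^ k)⁻¹ * g) ∈ N := by
    have h := QuotientGroup.eq.mp ((QuotientGroup.mk_pow _ x k).trans hk)
    simpa [Subgroup.mem_subgroupOf] using h
  have hg' : g = (x : G) ^ k * ((⟨_, hn⟩ : N) : G) := by simp
  rw [hg', map_mul, Module.End.mul_apply, hvW, map_smul, hpow, smul_smul]
  exact Submodule.smul_mem _ _ (Submodule.mem_span_singleton_self v)

open scoped ComplexOrder in
theorem trace_weightProj_le_one [Finite G] [FiniteDimensional ℂ V] [N.Normal] [Fintype N]
    (hρ : ρ.IsIrreducible) {c : N →* ℂ}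
    (hcyc : IsCyclic (inertia N c ⧸ N.subgroupOf (inertia N c))) :
    LinearMap.trace ℂ V (weightProj ρ N c) ≤ 1 := by
  by_cases hne : weightSpace ρ N c = ⊥
  · have h : weightProj ρ N c = 0 := by
      ext v
      have := weightProj_mem ρ N c v
      rwa [hne, Submodule.mem_bot] at this
    rw [h, map_zero]
    exact zero_le_one
  obtain ⟨v, hvW, hv, hspan⟩ := exists_inertia_eigenvector ρ N hcyc hne
  -- The image need only be checked on the orbit of `v`, split by membership in the inertia group.
  have hproj : LinearMap.IsProj (Submodule.span ℂ {v}) (weightProj ρ N c) := by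
    refine ⟨fun w => ?_, fun w hw => ?_⟩
    · have hw : w ∈ Submodule.span ℂ (Set.range fun g => ρ g v) := by
        rw [span_range_orbit_eq_top ρ hρ hv]
        exact Submodule.mem_top
      induction hw using Submodule.span_induction with
      | mem x hx =>
        obtain ⟨g, rfl⟩ := hx
        by_cases hg : g ∈ inertia N c
        · simpa only [weightProj_eq_self ρ N (rho_mem_weightSpace ρ N hg hvW)] using hspan g hg
        · simp only [weightProj_rho_eq_zero ρ N hg hvW, zero_mem]
      | zero => simp
      | add x y _ _ hx hy => rw [map_add]; exact add_mem hx hy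
      | smul a x _ hx => rw [map_smul]; exact Submodule.smul_mem _ a hx
    · exact weightProj_eq_self ρ N
        ((Submodule.span_singleton_le_iff_mem v _).mpr hvW hw)
  rw [hproj.trace, finrank_span_singleton hv, Nat.cast_one]

/-- Values of `c` are roots of unity, so conjugation inverts them. -/
theorem charInner_restrict_eq_trace [Finite G] [Fintype N] (c : N →* ℂ) :
    charInner (fun n : N => ρ.character (n : G)) c = LinearMap.trace ℂ V (weightProj ρ N c) := by
  have hconj : ∀ n : N, (starRingEnd ℂ) (c n) = c n⁻¹ := by
    intro n
    have hnorm : ‖c n‖ = 1 := (c.isOfFinOrder (isOfFinOrder_of_finite n)).norm_eq_one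
    rw [← Complex.inv_eq_conj hnorm]
    exact inv_eq_of_mul_eq_one_right (map_mul_map_inv N c n)
  rw [charInner, finsum_eq_sum_of_fintype, weightProj, map_smul, map_sum, smul_eq_mul]
  congr 1
  refine Finset.sum_congr rfl fun n _ => ?_
  rw [hconj, map_smul, smul_eq_mul, mul_comm]
  rfl

end WeightProjection

/-- Irreducible characters of abelian groups are multiplicative. -/
theorem exists_monoidHom_of_mem_Irr {A : Type u} [Group A] [IsMulCommutative A] {μ : A → ℂ}
    (hμ : μ ∈ Irr A) : ∃ c : A →* ℂ, ⇑c = μ := by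
  obtain ⟨V, _, _, _, σ, hσ, rfl⟩ := hμ
  have h1 : Module.finrank ℂ V = 1 :=
    Representation.IsIrreducible.finrank_eq_one_of_isMulCommutative σ
  have hscalar : ∀ a : A, σ a = σ.character a • LinearMap.id := by
    intro a
    obtain ⟨t, ht⟩ := (LinearMap.existsUnique_eq_smul_id_of_finrank_eq_one h1 (σ a)).exists
    rw [Representation.character, ht, map_smul, LinearMap.trace_id, h1]
    simp
  refine ⟨{ toFun := σ.character, map_one' := ?_, map_mul' := fun a b => ?_ }, rfl⟩
  · simp [Representation.character, h1]
  · rw [Representation.character, map_mul, hscalar a, smul_mul_assoc, map_smul, smul_eq_mul]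
    rfl

theorem isUnramifiedOver_of_isCyclic_inertia_quotient {G : Type u} [Group G] [Finite G]
    (N : Subgroup G) [hN : N.Normal] [hA : IsMulCommutative N] (hne : N ≠ ⊥)
    (hcyc : ∀ μ ∈ Irr N, IsCyclic (inertia N μ ⧸ N.subgroupOf (inertia N μ))) :
    IsUnramifiedOver N := by
  refine ⟨hN, hA, hne, fun V _ _ _ ρ hρ => Or.inl fun μ hμ => ?_⟩
  have := Fintype.ofFinite N
  have hI := hcyc μ hμ
  obtain ⟨c, rfl⟩ := exists_monoidHom_of_mem_Irr hμ
  rw [charInner_restrict_eq_trace]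
  exact trace_weightProj_le_one ρ N hρ hI

theorem isCyclic_quotient_subgroupOf {G : Type u} [Group G] (N H : Subgroup G) [N.Normal]
    [IsCyclic (G ⧸ N)] : IsCyclic (H ⧸ N.subgroupOf H) := by
  refine isCyclic_of_injective
    -- The inclusion of `H` embeds its quotient in the cyclic group `G ⧸ N`.
    (QuotientGroup.map (N.subgroupOf H) N H.subtype le_rfl) ?_
  rw [injective_iff_map_eq_one]
  intro q hq
  obtain ⟨h, rfl⟩ := QuotientGroup.mk_surjective q
  replace hq : (h : G) ∈ N := (QuotientGroup.eq_one_iff (h : G)).mp hq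
  exact (QuotientGroup.eq_one_iff h).mpr hq

theorem isUnramifiedOver_of_isCyclic_quotient {G : Type u} [Group G] [Finite G]
    (N : Subgroup G) [N.Normal] [IsMulCommutative N] (hne : N ≠ ⊥) (hcyc : IsCyclic (G ⧸ N)) :
    IsUnramifiedOver N :=
  isUnramifiedOver_of_isCyclic_inertia_quotient N hne fun μ _ =>
    isCyclic_quotient_subgroupOf N (inertia N μ)

theorem IsMetacyclic.isTotallyUnramified {G : Type u} [Group G] [Finite G] (h : IsMetacyclic G) :
    IsTotallyUnramified G := by
  obtain ⟨N, _, hN, hq⟩ := h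
  by_cases hne : N = ⊥
  -- Unramifiedness requires `N ≠ ⊥`; for trivial `N`, `G` itself is cyclic.
  · subst hne
    have : IsCyclic G := isCyclic_of_surjective (QuotientGroup.quotientBot (G := G))
      (QuotientGroup.quotientBot (G := G)).surjective
    exact .of_abelian G inferInstance
  · exact .of_quotient G N (isUnramifiedOver_of_isCyclic_quotient N hne hq)
      (.of_abelian _ inferInstance)

theorem mainTheorem8 (G : Type u) [Group G] [Finite G] :
    (∀ (N : Subgroup G) [N.Normal] [IsMulCommutative N], N ≠ ⊥ →
      (∀ μ ∈ Irr N, IsCyclic (inertia N μ ⧸ N.subgroupOf (inertia N μ))) →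
        IsUnramifiedOver N) ∧
    (∀ (N : Subgroup G) [N.Normal] [IsMulCommutative N], N ≠ ⊥ →
      IsCyclic (G ⧸ N) → IsUnramifiedOver N) ∧
    (IsMetacyclic G → IsTotallyUnramified G) :=
  ⟨fun N _ _ => isUnramifiedOver_of_isCyclic_inertia_quotient N,
    fun N _ _ => isUnramifiedOver_of_isCyclic_quotient N, IsMetacyclic.isTotallyUnramified⟩
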